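/- Let $\mathcal G=(\mathcal V,\mathcal E)$ be a finite simple graph on sensors $\mathcal V=\{1,\dots,n\}$. Let $a_1,\dots,a_m\in\mathbb R^p$ be anchor positions, and let $\mathcal A_i\subseteq\{1,\dots,m\}$ be the set of anchors with a measured range to sensor $i$. Let $d_{ij}\ge 0$ (for $i\sim j$) and $r_{ik}\ge 0$ (for $k\in\mathcal A_i$) be the measured ranges, and let $D_{ij}>0$, $R_{ik}>0$ be Huber radii, with $d_{ij}=d_{ji}$ and $D_{ij}=D_{ji}$. Put $h_\delta(u)=u^2$ if $|u|\le\delta$ and $h_\delta(u)=2\delta|u|-\delta^2$ otherwise, and $\psi_\delta(u)=h_\delta(\|u\|)$ for $u\in\mathbb R^p$, with $\|\cdot\|$ the Euclidean norm. For $z=(x,y,w)$ with $x=(x_i)_{i\in\mathcal V}$, $y=(y_{ij})_{i\sim j}$ (one vector per edge, with $y_{ji}=-y_{ij}$) and $w=(w_{ik})_{i\in\mathcal V,\,k\in\mathcal A_i}$, all entries in $\mathbb R^p$, let $$F(z)=\sum_{i\sim j}\tfrac12\psi_{D_{ij}}(x_i-x_j-y_{ij})+\sum_i\sum_{k\in\mathcal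 A_i}\tfrac12\psi_{R_{ik}}(x_i-a_k-w_{ik}),$$ where each edge is counted once, and $$\mathcal Z=\{z:\ \|y_{ij}\|\le d_{ij}\ (i\sim j),\ \|w_{ik}\|\le r_{ik}\ (k\in\mathcal A_i,\ i\in\mathcal V)\},\quad F^\star=\inf_{z\in\mathcal Z}F(z),\quad \mathcal Z^\star=\{z\in\mathcal Z: F(z)=F^\star\}.$$ For a node $i$ with neighbour set $\mathcal N_i$, let $F_i$ be the part of $F$ that involves node $i$, as a function of the variables of node $i$ with $x_j$ $(j\neq i)$ fixed: $$F_i(x_i,\{y_{ij}\}_{j\in\mathcal N_i},\{w_{ik}\}_{k\in\mathcal A_i})=\sum_{j\in\mathcal N_i}\tfrac12\psi_{D_{ij}}(x_i-x_j-y_{ij})+\sum_{k\in\mathcal A_i}\tfrac12\psi_{R_{ik}}(x_i-a_k-w_{ik}).$$ Asynchronous algorithm (asyncSTRONG). Let $(\chi_t)_{t\in\mathbb N}$ be independent random variables with values in $\mathcal V$ and $\mathbb P(\chi_t=i)=P_i>0$ for all $t$ and $i$. The initial positions $x^0$ are arbitrary (possibly random), $y^0_{ij}$ is the projection of $x^0_i-x^0_j$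 onto the closed ball of radius $d_{ij}$ centred at $0$, and $w^0_{ik}$ is the projection of $x^0_i-a_k$ onto the closed ball of radius $r_{ik}$ centred at $0$. For $t\ge1$, node $i=\chi_t$ replaces its variables $(x_i,\{y_{ij}\}_{j\in\mathcal N_i},\{w_{ik}\}_{k\in\mathcal A_i})$ by some minimizer of $F_i$ subject to $\|y_{ij}\|\le d_{ij}$, $\|w_{ik}\|\le r_{ik}$, with the current positions of its neighbours held fixed; all other variables keep their values. Let $z^t$ be the iterate after $t$ steps. **Theorem.** Assume that $\mathcal G$ is connected and that at least one node has an anchor measurement, i.e. $\mathcal A_i\ne\varnothing$ for some $i$. Then $\mathcal Z^\star\neq\varnothing$, and 1. $\operatorname{dist}(z^t,\mathcal Z^\star)\to0$ almost surely, where $\operatorname{dist}$ is the Euclidean distance; 2. $F(z^t)\to F^\star$ almost surely. -/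

import Mathlib

open MeasureTheory ProbabilityTheory Filter Topology

noncomputable section

/-- The Huber loss with radius `δ`. -/
def huber (δ u : ℝ) : ℝ := if |u| ≤ δ then u ^ 2 else 2 * δ * |u| - δ ^ 2

/-- The Huber loss composed with the Euclidean norm, `ψ_δ(u) = h_δ(‖u‖)`. -/
def huberNorm {p : ℕ} (δ : ℝ) (u : EuclideanSpace ℝ (Fin p)) : ℝ := huber δ ‖u‖

/-- Orthogonal projection onto the closed ball of radius `ρ` centred at the origin. -/
def ballProj {p : ℕ} (ρ : ℝ) (u : EuclideanSpace ℝ (Fin p)) : EuclideanSpace ℝ (Fin p) :=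
  if ‖u‖ ≤ ρ then u else (ρ / ‖u‖) • u

/-- The data of a range-based localization problem in `ℝ^p` with sensors `Fin n` and anchors
`Fin m`: the measurement graph, an agreed direction for each edge, the anchors measured by each
sensor, the anchor positions, the measured ranges and the Huber radii. The ranges and radii of an
edge are symmetric because they are indexed by the unordered edge. -/
structure Network (p n m : ℕ) where
  /-- the measurement graph between sensors -/
  graph : SimpleGraph (Fin n)
  /-- first endpoint of each edge in the agreed direction -/
  tail : graph.edgeSet → Fin n
  /-- second endpoint of each edge in the agreed direction -/
  head : graph.edgeSet → Fin n
  /-- the two are indeed the endpoints of the edge -/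
  orient : ∀ e, s(tail e, head e) = (e : Sym2 (Fin n))
  /-- the set `A_i` of anchors with measured range to sensor `i` -/
  anchorsOf : Fin n → Finset (Fin m)
  /-- the anchor positions `a_k` -/
  anchorPos : Fin m → EuclideanSpace ℝ (Fin p)
  /-- ranges `d_ij` between sensors -/
  d : graph.edgeSet → ℝ
  /-- Huber radii `D_ij` -/
  D : graph.edgeSet → ℝ
  /-- ranges `r_ik` between sensors and anchors -/
  r : (Σ i : Fin n, {k : Fin m // k ∈ anchorsOf i}) → ℝ
  /-- Huber radii `R_ik` -/
  R : (Σ i : Fin n, {k : Fin m // k ∈ anchorsOf i}) → ℝ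
  d_nonneg : ∀ e, 0 ≤ d e
  r_nonneg : ∀ l, 0 ≤ r l
  D_pos : ∀ e, 0 < D e
  R_pos : ∀ l, 0 < R l

namespace Network

variable {p n m : ℕ} (N : Network p n m)

/-- The edges `i ∼ j` of the measurement graph. -/
abbrev Edge : Type := N.graph.edgeSet

/-- The node-anchor pairs `(i, k)` with `k ∈ A_i`. -/
abbrev Link : Type := Σ i : Fin n, {k : Fin m // k ∈ N.anchorsOf i}

instance instFintypeEdge : Fintype N.Edge := Fintype.ofFinite _

/-- The labels of the vector variables: one `x_i` per sensor, one `y_ij` per edge, one `w_ik` per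
node-anchor pair. -/
abbrev Coord : Type := Fin n ⊕ N.Edge ⊕ N.Link

/-- The aggregated variable `z = (x, y, w)`, with the Euclidean norm. -/
abbrev State : Type := PiLp 2 (fun _ : N.Coord => EuclideanSpace ℝ (Fin p))

/-- The component `x_i` of `z`. -/
def x (z : N.State) (i : Fin n) : EuclideanSpace ℝ (Fin p) := z (Sum.inl i)

/-- The component `y_ij` of `z`, for the edge `i ∼ j` directed from `i` to `j`. There is one
variable per edge: seen from the other endpoint it reads `y_ji = -y_ij`. -/
def y (z : N.State) (e : N.Edge) : EuclideanSpace ℝ (Fin p) := z (Sum.inr (Sum.inl e))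

/-- The component `w_ik` of `z`. -/
def w (z : N.State) (l : N.Link) : EuclideanSpace ℝ (Fin p) := z (Sum.inr (Sum.inr l))

/-- The constraint set `Z`. -/
def feasible : Set N.State :=
  {z | (∀ e, ‖N.y z e‖ ≤ N.d e) ∧ ∀ l, ‖N.w z l‖ ≤ N.r l}

/-- The cost of an edge, `½ ψ_{D_ij}(x_i - x_j - y_ij)`. It does not depend on the direction of
the edge, since reversing it negates the argument. -/
def edgeCost (z : N.State) (e : N.Edge) : ℝ :=
  1 / 2 * huberNorm (N.D e) (N.x z (N.tail e) - N.x z (N.head e) - N.y z e)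

/-- The cost of a node-anchor pair, `½ ψ_{R_ik}(x_i - a_k - w_ik)`. -/
def linkCost (z : N.State) (l : N.Link) : ℝ :=
  1 / 2 * huberNorm (N.R l) (N.x z l.1 - N.anchorPos l.2 - N.w z l)

/-- The cost function `F`. -/
def F (z : N.State) : ℝ := ∑ e, N.edgeCost z e + ∑ l, N.linkCost z l

/-- The optimal value `F⋆` of `F` over `Z`. -/
def Fstar : ℝ := sInf (N.F '' N.feasible)

/-- The solution set `Z⋆`. -/
def solutionSet : Set N.State := {z | z ∈ N.feasible ∧ N.F z = N.Fstar}

open Classical in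
/-- The local function `F_i`: the terms of `F` that involve node `i`, that is, its incident edges
and its anchors. -/
def localCost (i : Fin n) (z : N.State) : ℝ :=
  (∑ e ∈ Finset.univ.filter (fun e : N.Edge => i ∈ (e : Sym2 (Fin n))), N.edgeCost z e) +
    ∑ k : {k : Fin m // k ∈ N.anchorsOf i}, N.linkCost z ⟨i, k⟩

/-- The variables of node `i`: `x_i`, the `y_ij` with `j` a neighbour of `i`, and the `w_ik`. -/
def InBlock (i : Fin n) : N.Coord → Prop
  | Sum.inl j => j = i
  | Sum.inr (Sum.inl e) => i ∈ (e : Sym2 (Fin n))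
  | Sum.inr (Sum.inr l) => l.1 = i

/-- The feasible points that differ from `z` only in the variables of node `i`. -/
def blockFeasible (i : Fin n) (z : N.State) : Set N.State :=
  {z' | z' ∈ N.feasible ∧ ∀ c, ¬ N.InBlock i c → z' c = z c}

/-- `z'` is a result of the update of node `i` at `z`: the variables of node `i` are replaced by
some exact minimizer of `F_i`, everything else keeps its value. -/
def IsUpdate (i : Fin n) (z z' : N.State) : Prop :=
  z' ∈ N.blockFeasible i z ∧ IsMinOn (N.localCost i) (N.blockFeasible i z) z'

/-- `z` is a trajectory of asyncSTRONG for the order of activation `χ 1, χ 2, …`: the initial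
positions are arbitrary, the initial `y` and `w` are the projections of the initial differences,
and step `t + 1` is the update of node `χ (t + 1)`. -/
structure IsAsyncRun (χ : ℕ → Fin n) (z : ℕ → N.State) : Prop where
  init_y : ∀ e, N.y (z 0) e =
    ballProj (N.d e) (N.x (z 0) (N.tail e) - N.x (z 0) (N.head e))
  init_w : ∀ l, N.w (z 0) l = ballProj (N.r l) (N.x (z 0) l.1 - N.anchorPos l.2)
  step : ∀ t, N.IsUpdate (χ (t + 1)) (z t) (z (t + 1))

end Network

end

/-! The gradient of `½ψ_δ` is the projection onto the ball of radius `δ`, and `½ψ_δ` exceeds its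
tangent by at least half the squared change of gradient (`half_huberNorm_lower`). An exact block
update therefore lowers `F` by at least half the sum of the squared changes of the term gradients
(`IsUpdate.descent`). Since `F` is bounded below, these changes tend to 0 along every trajectory.

The initial projections make all `y` and `w` optimal for the initial positions, and updates preserve
this (`IsAsyncRun.slackOptimal`). By convexity the gap `F(z^t) - F⋆` is then controlled by the
gradients in the `x_i` alone (`SlackOptimal.F_sub_le`), times distances that stay bounded because
the graph is connected and has an anchor. The `i`-th gradient vanishes right after node `i` is
updated. Almost surely, infinitely many windows of `n` steps activate the nodes in order
(`ae_frequently_forall_eq`). Gradients barely move across a late window, so all are small at its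
start. The gap thus tends to 0 along a subsequence, hence along the whole sequence by monotonicity;
compact sublevel sets turn this into convergence of the distance. -/

noncomputable section

/-! ### Ball projections and the Huber loss -/

section Huber

variable {p : ℕ} {δ : ℝ}

/-- Clipping is a nonnegative rescaling, so it maps normal vectors of a convex set to normal
vectors. -/
theorem ballProj_eq_smul (hδ : 0 ≤ δ) (u : EuclideanSpace ℝ (Fin p)) :
    ∃ c : ℝ, 0 ≤ c ∧ ballProj δ u = c • u := by
  unfold ballProj
  split_ifs
  · exact ⟨1, zero_le_one, (one_smul ℝ u).symm⟩
  · exact ⟨_, by positivity, rfl⟩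

theorem norm_ballProj_le (hδ : 0 ≤ δ) (u : EuclideanSpace ℝ (Fin p)) : ‖ballProj δ u‖ ≤ δ := by
  unfold ballProj
  split_ifs with h
  · exact h
  · have hu : 0 < ‖u‖ := by linarith
    rw [norm_smul, Real.norm_of_nonneg (by positivity), div_mul_cancel₀ _ hu.ne']

/-- The variational characterization of the projection onto a ball. -/
theorem inner_sub_ballProj_nonpos (hδ : 0 ≤ δ) (u : EuclideanSpace ℝ (Fin p))
    {v : EuclideanSpace ℝ (Fin p)} (hv : ‖v‖ ≤ δ) :
    inner ℝ (u - ballProj δ u) (v - ballProj δ u) ≤ 0 := by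
  unfold ballProj
  split_ifs with h
  · simp
  · have hu : 0 < ‖u‖ := by linarith
    have h1 : u - (δ / ‖u‖) • u = (1 - δ / ‖u‖) • u := by rw [sub_smul, one_smul]
    rw [h1, real_inner_smul_left, inner_sub_right, real_inner_smul_right,
      real_inner_self_eq_norm_sq]
    have h2 : δ / ‖u‖ * ‖u‖ ^ 2 = δ * ‖u‖ := by field_simp
    have h3 : inner ℝ u v ≤ δ * ‖u‖ := by
      calc inner ℝ u v ≤ ‖u‖ * ‖v‖ := real_inner_le_norm u v
        _ ≤ δ * ‖u‖ := by nlinarith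
    have h4 : δ / ‖u‖ ≤ 1 := by rw [div_le_one hu]; linarith
    rw [h2]
    exact mul_nonpos_of_nonneg_of_nonpos (by linarith) (by linarith)

/-- The clipped residual of a projected point is an outward normal of the ball. -/
theorem inner_ballProj_residual_nonpos {ρ : ℝ} (hδ : 0 ≤ δ) (hρ : 0 ≤ ρ)
    (u : EuclideanSpace ℝ (Fin p)) {v : EuclideanSpace ℝ (Fin p)} (hv : ‖v‖ ≤ ρ) :
    inner ℝ (ballProj δ (u - ballProj ρ u)) (v - ballProj ρ u) ≤ 0 := by
  obtain ⟨c, hc, h⟩ := ballProj_eq_smul hδ (u - ballProj ρ u)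
  rw [h, real_inner_smul_left]
  exact mul_nonpos_of_nonneg_of_nonpos hc (inner_sub_ballProj_nonpos hρ u hv)

/-- The Huber loss as a concave expression in its gradient. -/
theorem half_huberNorm_eq (u : EuclideanSpace ℝ (Fin p)) (hδ : 0 ≤ δ) :
    1 / 2 * huberNorm δ u = inner ℝ (ballProj δ u) u - 1 / 2 * ‖ballProj δ u‖ ^ 2 := by
  unfold huberNorm huber ballProj
  rw [abs_norm]
  split_ifs with h
  · rw [real_inner_self_eq_norm_sq]; ring
  · have hu : 0 < ‖u‖ := by linarith
    rw [real_inner_smul_left, real_inner_self_eq_norm_sq, norm_smul,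
      Real.norm_of_nonneg (by positivity)]
    field_simp

/-- Duality: `½ψ_δ(v)` is the maximum of `⟪g, v⟫ - ½‖g‖²` over `‖g‖ ≤ δ`, attained at `ballProj δ
v`. Strong concavity in `g` gives the quadratic loss at the competitor `g = ballProj δ u`. -/
theorem half_huberNorm_lower (hδ : 0 ≤ δ) (u v : EuclideanSpace ℝ (Fin p)) :
    1 / 2 * huberNorm δ u + inner ℝ (ballProj δ u) (v - u)
      + 1 / 2 * ‖ballProj δ v - ballProj δ u‖ ^ 2 ≤ 1 / 2 * huberNorm δ v := by
  have h := inner_sub_ballProj_nonpos hδ v (norm_ballProj_le hδ u)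
  rw [half_huberNorm_eq u hδ, half_huberNorm_eq v hδ, norm_sub_sq_real]
  simp only [inner_sub_left, inner_sub_right, real_inner_self_eq_norm_sq] at h ⊢
  rw [real_inner_comm (ballProj δ u) v, real_inner_comm (ballProj δ v) v] at h
  linarith

/-- The lower bound with `u` and `v` exchanged, then Cauchy–Schwarz and Young. The constant is not
sharp; only the quadratic order of the error is needed. -/
theorem half_huberNorm_upper (hδ : 0 ≤ δ) (u v : EuclideanSpace ℝ (Fin p)) :
    1 / 2 * huberNorm δ v ≤
      1 / 2 * huberNorm δ u + inner ℝ (ballProj δ u) (v - u) + ‖v - u‖ ^ 2 := by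
  have h1 := half_huberNorm_lower hδ u v
  have h2 := half_huberNorm_lower hδ v u
  rw [norm_sub_rev (ballProj δ u)] at h2
  have h3 : inner ℝ (ballProj δ v) (u - v) =
      -inner ℝ (ballProj δ u) (v - u) - inner ℝ (ballProj δ v - ballProj δ u) (v - u) := by
    simp only [inner_sub_left, inner_sub_right]; ring
  have h4 := real_inner_le_norm (ballProj δ v - ballProj δ u) (v - u)
  nlinarith [sq_nonneg (‖ballProj δ v - ballProj δ u‖ - ‖v - u‖)]

theorem huberNorm_nonneg (hδ : 0 ≤ δ) (u : EuclideanSpace ℝ (Fin p)) : 0 ≤ huberNorm δ u := by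
  unfold huberNorm huber
  rw [abs_norm]
  split_ifs with h
  · positivity
  · nlinarith

/-- Linear growth of the loss, the source of coercivity. -/
theorem norm_le_half_huberNorm (hδ : 0 < δ) (u : EuclideanSpace ℝ (Fin p)) :
    ‖u‖ ≤ (1 / 2 * huberNorm δ u + δ ^ 2 / 2) / δ := by
  rw [le_div_iff₀ hδ]
  unfold huberNorm huber
  rw [abs_norm]
  split_ifs with h
  · nlinarith [sq_nonneg (‖u‖ - δ)]
  · nlinarith

theorem continuous_huberNorm (δ : ℝ) :
    Continuous (huberNorm δ : EuclideanSpace ℝ (Fin p) → ℝ) := by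
  have h : Continuous (huber δ) := by
    refine Continuous.if_le (by fun_prop) (by fun_prop) (by fun_prop) (by fun_prop) ?_
    intro u hu
    rw [← sq_abs, hu]; ring
  exact h.comp continuous_norm

end Huber

/-! ### The cost as a sum of terms: derivatives and first-order bounds -/

namespace Network

variable {p n m : ℕ} (N : Network p n m)

/-- The labels of the terms of the cost, which are also those of the slack variables. -/
abbrev Term : Type := N.Edge ⊕ N.Link

/-- The measured range of a term. -/
def range : N.Term → ℝ := Sum.elim N.d N.r

/-- The Huber radius of a term. -/
def radius : N.Term → ℝ := Sum.elim N.D N.R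

theorem range_nonneg (c : N.Term) : 0 ≤ N.range c := by
  rcases c with e | l
  exacts [N.d_nonneg e, N.r_nonneg l]

theorem radius_pos (c : N.Term) : 0 < N.radius c := by
  rcases c with e | l
  exacts [N.D_pos e, N.R_pos l]

/-- The displacement whose length is measured by a term. -/
def displacement (z : N.State) : N.Term → EuclideanSpace ℝ (Fin p) :=
  Sum.elim (fun e => N.x z (N.tail e) - N.x z (N.head e))
    (fun l => N.x z l.1 - N.anchorPos l.2)

/-- The argument of the Huber loss in a term. -/
def residual (z : N.State) (c : N.Term) : EuclideanSpace ℝ (Fin p) :=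
  N.displacement z c - z (Sum.inr c)

/-- The cost of a term. -/
def termCost (z : N.State) (c : N.Term) : ℝ :=
  1 / 2 * huberNorm (N.radius c) (N.residual z c)

/-- The gradient of a term with respect to its residual. -/
def termGrad (z : N.State) (c : N.Term) : EuclideanSpace ℝ (Fin p) :=
  ballProj (N.radius c) (N.residual z c)

/-- The coefficient of `x_i` in the displacement of a term. -/
def incidence (i : Fin n) : N.Term → ℝ :=
  Sum.elim (fun e => (if i = N.tail e then 1 else 0) - (if i = N.head e then 1 else 0))
    (fun l => if i = l.1 then 1 else 0)

/-- The gradient of `F` with respect to `x_i`. -/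
def nodeGrad (z : N.State) (i : Fin n) : EuclideanSpace ℝ (Fin p) :=
  ∑ c, N.incidence i c • N.termGrad z c

theorem abs_incidence_le (i : Fin n) (c : N.Term) : |N.incidence i c| ≤ 1 := by
  rcases c with e | l <;> simp only [incidence, Sum.elim_inl, Sum.elim_inr] <;>
    split_ifs <;> norm_num

theorem F_eq_sum_termCost (z : N.State) : N.F z = ∑ c, N.termCost z c := by
  rw [Fintype.sum_sum_type]
  rfl

theorem mem_feasible_iff {z : N.State} :
    z ∈ N.feasible ↔ ∀ c : N.Term, ‖z (Sum.inr c)‖ ≤ N.range c := by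
  constructor
  · rintro ⟨h1, h2⟩ (e | l)
    exacts [h1 e, h2 l]
  · exact fun h => ⟨fun e => h (Sum.inl e), fun l => h (Sum.inr l)⟩

theorem residual_sub (u z : N.State) (c : N.Term) :
    N.residual u c - N.residual z c =
      ∑ i, N.incidence i c • (u (Sum.inl i) - z (Sum.inl i))
        - (u (Sum.inr c) - z (Sum.inr c)) := by
  rcases c with e | l
  · simp only [residual, displacement, incidence, x, Sum.elim_inl, sub_smul, ite_smul, one_smul,
      zero_smul, Finset.sum_sub_distrib, Finset.sum_ite_eq', Finset.mem_univ,
      if_true]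
    abel
  · simp only [residual, displacement, incidence, x, Sum.elim_inr, ite_smul, one_smul,
      zero_smul, Finset.sum_ite_eq', Finset.mem_univ, if_true]
    abel

/-- The derivative of `F` at `z` in the direction `u - z`, by coordinates. -/
theorem sum_inner_termGrad (z u v : N.State) :
    ∑ c, inner ℝ (N.termGrad z c) (N.residual u c - N.residual v c) =
      ∑ i, inner ℝ (N.nodeGrad z i) (u (Sum.inl i) - v (Sum.inl i))
        - ∑ c : N.Term, inner ℝ (N.termGrad z c) (u (Sum.inr c) - v (Sum.inr c)) := by
  simp only [residual_sub, inner_sub_right (𝕜 := ℝ) (N.termGrad z _) (Finset.sum _ _),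
    Finset.sum_sub_distrib, nodeGrad, sum_inner, inner_sum]
  rw [Finset.sum_comm]
  simp only [real_inner_smul_left, real_inner_smul_right]

theorem F_lower (z u : N.State) :
    N.F z + ∑ c, inner ℝ (N.termGrad z c) (N.residual u c - N.residual z c)
      + 1 / 2 * ∑ c, ‖N.termGrad u c - N.termGrad z c‖ ^ 2 ≤ N.F u := by
  rw [F_eq_sum_termCost, F_eq_sum_termCost, Finset.mul_sum, ← Finset.sum_add_distrib,
    ← Finset.sum_add_distrib]
  exact Finset.sum_le_sum fun c _ => half_huberNorm_lower (N.radius_pos c).le _ _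

theorem F_upper (z u : N.State) :
    N.F u ≤ N.F z + ∑ c, inner ℝ (N.termGrad z c) (N.residual u c - N.residual z c)
      + ∑ c, ‖N.residual u c - N.residual z c‖ ^ 2 := by
  rw [F_eq_sum_termCost, F_eq_sum_termCost, ← Finset.sum_add_distrib, ← Finset.sum_add_distrib]
  exact Finset.sum_le_sum fun c _ => half_huberNorm_upper (N.radius_pos c).le _ _

theorem termCost_nonneg (z : N.State) (c : N.Term) : 0 ≤ N.termCost z c :=
  mul_nonneg (by norm_num) (huberNorm_nonneg (N.radius_pos c).le _)

theorem F_nonneg (z : N.State) : 0 ≤ N.F z := by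
  rw [F_eq_sum_termCost]
  exact Finset.sum_nonneg fun c _ => N.termCost_nonneg z c

theorem continuous_F : Continuous N.F := by
  have h : N.F = fun z => ∑ c, N.termCost z c := funext N.F_eq_sum_termCost
  rw [h]
  refine continuous_finsetSum _ fun c _ => continuous_const.mul
    ((continuous_huberNorm _).comp ?_)
  rcases c with e | l <;> simp only [residual, displacement, x, Sum.elim_inl, Sum.elim_inr] <;>
    fun_prop

theorem isClosed_feasible : IsClosed N.feasible := by
  have h : N.feasible = ⋂ c : N.Term, {z : N.State | ‖z (Sum.inr c)‖ ≤ N.range c} := by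
    ext z
    simp [mem_feasible_iff]
  rw [h]
  exact isClosed_iInter fun c => isClosed_le (by fun_prop) continuous_const

/-! ### Updates -/

variable {N}

/-- A term whose slack lies outside the block of `i` does not involve `x_i` either. -/
theorem residual_eq_of_not_inBlock {i : Fin n} {z u : N.State}
    (h : ∀ c, ¬ N.InBlock i c → u c = z c) {c : N.Term} (hc : ¬ N.InBlock i (Sum.inr c)) :
    N.residual u c = N.residual z c := by
  unfold residual
  rw [h _ hc]
  congr 1
  rcases c with e | l
  · have he : i ∉ (e : Sym2 (Fin n)) := hc
    rw [← N.orient e, Sym2.mem_iff, not_or] at he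
    have h1 : u (Sum.inl (N.tail e)) = z (Sum.inl (N.tail e)) := h _ fun h => he.1 h.symm
    have h2 : u (Sum.inl (N.head e)) = z (Sum.inl (N.head e)) := h _ fun h => he.2 h.symm
    simp only [displacement, x, Sum.elim_inl, h1, h2]
  · have h1 : u (Sum.inl l.1) = z (Sum.inl l.1) := h _ fun h => hc h
    simp only [displacement, x, Sum.elim_inr, h1]

open Classical in
theorem localCost_eq (i : Fin n) (z : N.State) :
    N.localCost i z =
      ∑ c with N.InBlock i (Sum.inr c), N.termCost z c := by
  rw [Finset.sum_filter, Fintype.sum_sum_type, localCost, Finset.sum_filter]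
  refine congrArg₂ (· + ·) (Finset.sum_congr rfl fun e _ => if_congr Iff.rfl rfl rfl) ?_
  symm
  rw [Fintype.sum_sigma, Finset.sum_eq_single i]
  · exact Finset.sum_congr rfl fun k _ => if_pos rfl
  · intro j _ hj
    exact Finset.sum_eq_zero fun k _ => if_neg hj
  · simp

theorem F_sub_eq_localCost_sub {i : Fin n} {z u : N.State}
    (h : ∀ c, ¬ N.InBlock i c → u c = z c) :
    N.F u - N.F z = N.localCost i u - N.localCost i z := by
  classical
  rw [localCost_eq, localCost_eq, F_eq_sum_termCost, F_eq_sum_termCost,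
    ← Finset.sum_filter_add_sum_filter_not _ (fun c => N.InBlock i (Sum.inr c)) (N.termCost u),
    ← Finset.sum_filter_add_sum_filter_not _ (fun c => N.InBlock i (Sum.inr c)) (N.termCost z)]
  have h1 : ∑ c with ¬ N.InBlock i (Sum.inr c), N.termCost u c =
      ∑ c with ¬ N.InBlock i (Sum.inr c), N.termCost z c := by
    refine Finset.sum_congr rfl fun c hc => ?_
    rw [termCost, termCost, residual_eq_of_not_inBlock h (Finset.mem_filter.1 hc).2]
  rw [h1]
  ring

/-- `F` and `F_i` differ by a constant on the block, so an update minimizes `F` itself there. -/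
theorem IsUpdate.F_le {i : Fin n} {z z' u : N.State} (h : N.IsUpdate i z z')
    (hu : u ∈ N.blockFeasible i z) : N.F z' ≤ N.F u := by
  have h1 : N.localCost i z' ≤ N.localCost i u := h.2 hu
  have h2 := F_sub_eq_localCost_sub h.1.2
  have h3 := F_sub_eq_localCost_sub hu.2
  linarith

theorem convex_blockFeasible (i : Fin n) (z : N.State) : Convex ℝ (N.blockFeasible i z) := by
  intro u hu v hv a b ha hb hab
  refine ⟨N.mem_feasible_iff.2 fun c => ?_, fun c hc => ?_⟩
  · have h1 := N.mem_feasible_iff.1 hu.1 c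
    have h2 := N.mem_feasible_iff.1 hv.1 c
    calc ‖a • u (Sum.inr c) + b • v (Sum.inr c)‖
        ≤ a * ‖u (Sum.inr c)‖ + b * ‖v (Sum.inr c)‖ := by
          refine (norm_add_le _ _).trans ?_
          rw [norm_smul, norm_smul, Real.norm_of_nonneg ha, Real.norm_of_nonneg hb]
      _ ≤ a * N.range c + b * N.range c := by gcongr
      _ = N.range c := by rw [← add_mul, hab, one_mul]
  · change a • u c + b • v c = z c
    rw [hu.2 c hc, hv.2 c hc, ← add_smul, hab, one_smul]

theorem residual_lineMap (z u : N.State) (s : ℝ) (c : N.Term) :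
    N.residual (z + s • (u - z)) c - N.residual z c = s • (N.residual u c - N.residual z c) := by
  rw [residual_sub, residual_sub, smul_sub _ (Finset.sum _ _), Finset.smul_sum]
  simp only [PiLp.add_apply, PiLp.smul_apply, PiLp.sub_apply, add_sub_cancel_left, smul_comm s]

theorem nonneg_of_forall_le_mul_sq {a b : ℝ}
    (h : ∀ s : ℝ, 0 < s → s ≤ 1 → 0 ≤ s * a + s ^ 2 * b) : 0 ≤ a := by
  have h1 : Tendsto (fun s : ℝ => a + s * b) (𝓝[>] 0) (𝓝 (a + 0 * b)) := by
    refine Tendsto.mono_left ?_ nhdsWithin_le_nhds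
    exact (by fun_prop : Continuous fun s : ℝ => a + s * b).tendsto 0
  rw [zero_mul, add_zero] at h1
  refine ge_of_tendsto h1 ?_
  filter_upwards [Ioc_mem_nhdsGT (zero_lt_one (α := ℝ))] with s hs
  have := h s hs.1 hs.2
  rw [show s * a + s ^ 2 * b = s * (a + s * b) by ring] at this
  exact nonneg_of_mul_nonneg_right this hs.1

/-- The first-order optimality condition of an update. -/
theorem IsUpdate.variational {i : Fin n} {z z' u : N.State} (h : N.IsUpdate i z z')
    (hu : u ∈ N.blockFeasible i z) :
    0 ≤ ∑ c, inner ℝ (N.termGrad z' c) (N.residual u c - N.residual z' c) := by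
  refine nonneg_of_forall_le_mul_sq
    (b := ∑ c, ‖N.residual u c - N.residual z' c‖ ^ 2) fun s hs0 hs1 => ?_
  -- Minimality is tested along the segment from `z'` to `u`, where the error of the linearization
  -- is of order `s ^ 2`.
  have h1 := h.F_le ((convex_blockFeasible i z).add_smul_sub_mem h.1 hu ⟨hs0.le, hs1⟩)
  have h2 := N.F_upper z' (z' + s • (u - z'))
  simp only [residual_lineMap, real_inner_smul_right, norm_smul, mul_pow, Real.norm_eq_abs,
    sq_abs, ← Finset.mul_sum] at h2
  linarith

/-- The old point is itself a competitor, so the linear term in the lower bound based at `z'` is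
nonnegative. Gradients are controlled here, not step lengths. -/
theorem IsUpdate.descent {i : Fin n} {z z' : N.State} (h : N.IsUpdate i z z')
    (hz : z ∈ N.feasible) :
    N.F z' + 1 / 2 * ∑ c, ‖N.termGrad z c - N.termGrad z' c‖ ^ 2 ≤ N.F z := by
  have h1 := h.variational (u := z) ⟨hz, fun _ _ => rfl⟩
  have h2 := N.F_lower z' z
  linarith

/-- The point obtained from `z` by setting one variable. -/
def setVar (z : N.State) (c : N.Coord) (v : EuclideanSpace ℝ (Fin p)) : N.State :=
  open Classical in WithLp.toLp 2 (Function.update z.ofLp c v)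

theorem setVar_same (z : N.State) (c : N.Coord) (v : EuclideanSpace ℝ (Fin p)) :
    setVar z c v c = v := by
  simp [setVar]

theorem setVar_of_ne (z : N.State) {c c' : N.Coord} (v : EuclideanSpace ℝ (Fin p))
    (h : c' ≠ c) : setVar z c v c' = z c' := by
  simp [setVar, h]

theorem setVar_mem_blockFeasible {i : Fin n} {z z' : N.State} (h : z' ∈ N.blockFeasible i z)
    {c : N.Coord} (hc : N.InBlock i c) {v : EuclideanSpace ℝ (Fin p)}
    (hv : ∀ c', c = Sum.inr c' → ‖v‖ ≤ N.range c') : setVar z' c v ∈ N.blockFeasible i z := by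
  refine ⟨N.mem_feasible_iff.2 fun c' => ?_, fun c' hc' => ?_⟩
  · by_cases hcc : Sum.inr c' = c
    · subst hcc
      rw [setVar_same]
      exact hv c' rfl
    · rw [setVar_of_ne _ _ hcc]
      exact N.mem_feasible_iff.1 h.1 c'
  · rw [setVar_of_ne _ _ fun hcc => hc' (by rw [hcc]; exact hc)]
    exact h.2 c' hc'

theorem IsUpdate.nodeGrad_eq_zero {i : Fin n} {z z' : N.State} (h : N.IsUpdate i z z') :
    N.nodeGrad z' i = 0 := by
  -- `x_i` is unconstrained, so a move against the gradient is an admissible test.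
  have h1 := h.variational (setVar_mem_blockFeasible h.1 (c := Sum.inl i) rfl
    (v := z' (Sum.inl i) - N.nodeGrad z' i) (by simp))
  rw [sum_inner_termGrad, Finset.sum_eq_single i, Finset.sum_eq_zero, setVar_same,
    sub_sub_cancel_left, inner_neg_right, real_inner_self_eq_norm_sq] at h1
  · have h2 : ‖N.nodeGrad z' i‖ = 0 := by
      nlinarith [norm_nonneg (N.nodeGrad z' i)]
    exact norm_eq_zero.1 h2
  · intro c _
    rw [setVar_of_ne _ _ (by simp), sub_self, inner_zero_right]
  · intro j _ hj
    rw [setVar_of_ne _ _ (by simpa using hj), sub_self, inner_zero_right]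
  · simp

variable (N) in
/-- Every slack variable of `z` is optimal for the positions of `z`. -/
def SlackOptimal (z : N.State) : Prop :=
  ∀ (c : N.Term) (v : EuclideanSpace ℝ (Fin p)), ‖v‖ ≤ N.range c →
    inner ℝ (N.termGrad z c) (v - z (Sum.inr c)) ≤ 0

/-- Inside the block, each slack can be varied alone in the variational inequality; outside, both
slack and residual are unchanged, so optimality is inherited. -/
theorem IsUpdate.slackOptimal {i : Fin n} {z z' : N.State} (h : N.IsUpdate i z z')
    (hz : N.SlackOptimal z) : N.SlackOptimal z' := by
  intro c v hv
  by_cases hc : N.InBlock i (Sum.inr c)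
  · have h1 := h.variational (setVar_mem_blockFeasible h.1 hc (v := v)
      (fun c' hc' => by rw [← Sum.inr_injective hc']; exact hv))
    rw [sum_inner_termGrad, Finset.sum_eq_zero, Finset.sum_eq_single c, setVar_same] at h1
    · linarith
    · intro c' _ hc'
      rw [setVar_of_ne _ _ (by simpa using hc'), sub_self, inner_zero_right]
    · simp
    · intro j _
      rw [setVar_of_ne _ _ (by simp), sub_self, inner_zero_right]
  · rw [termGrad, residual_eq_of_not_inBlock h.1.2 hc, h.1.2 _ hc]
    exact hz c v hv

/-- At a point with optimal slack variables, only the position gradients contribute to the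
suboptimality. -/
theorem SlackOptimal.F_sub_le {z u : N.State} (hz : N.SlackOptimal z) (hu : u ∈ N.feasible) :
    N.F z - N.F u ≤ ∑ i, ‖N.nodeGrad z i‖ * ‖z (Sum.inl i) - u (Sum.inl i)‖ := by
  have h1 := N.F_lower z u
  rw [sum_inner_termGrad] at h1
  have h2 : ∑ c : N.Term, inner ℝ (N.termGrad z c) (u (Sum.inr c) - z (Sum.inr c)) ≤ 0 :=
    Finset.sum_nonpos fun c _ => hz c _ (N.mem_feasible_iff.1 hu c)
  have h3 : -∑ i, inner ℝ (N.nodeGrad z i) (u (Sum.inl i) - z (Sum.inl i)) ≤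
      ∑ i, ‖N.nodeGrad z i‖ * ‖z (Sum.inl i) - u (Sum.inl i)‖ := by
    rw [← Finset.sum_neg_distrib]
    refine Finset.sum_le_sum fun i _ => ?_
    rw [← inner_neg_right, neg_sub]
    exact real_inner_le_norm _ _
  have h4 : 0 ≤ ∑ c, ‖N.termGrad u c - N.termGrad z c‖ ^ 2 :=
    Finset.sum_nonneg fun c _ => sq_nonneg _
  linarith

theorem norm_nodeGrad_sub_le (z u : N.State) (i : Fin n) :
    ‖N.nodeGrad z i - N.nodeGrad u i‖ ≤ ∑ c, ‖N.termGrad z c - N.termGrad u c‖ := by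
  simp only [nodeGrad, ← Finset.sum_sub_distrib, ← smul_sub]
  refine norm_sum_le_of_le _ fun c _ => ?_
  rw [norm_smul, Real.norm_eq_abs]
  exact mul_le_of_le_one_left (norm_nonneg _) (N.abs_incidence_le i c)

/-! ### Compactness of the sublevel sets -/

theorem norm_displacement_le {z : N.State} (hz : z ∈ N.feasible) {C : ℝ} (hC : N.F z ≤ C)
    (c : N.Term) : ‖N.displacement z c‖ ≤
      N.range c + (C + N.radius c ^ 2 / 2) / N.radius c := by
  have h0 := N.radius_pos c
  have h1 : N.termCost z c ≤ C := by
    refine le_trans ?_ hC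
    rw [F_eq_sum_termCost]
    exact Finset.single_le_sum (f := N.termCost z) (fun c _ => N.termCost_nonneg z c)
      (Finset.mem_univ c)
  have h2 : ‖N.residual z c‖ ≤ (C + N.radius c ^ 2 / 2) / N.radius c :=
    (norm_le_half_huberNorm h0 _).trans (by unfold termCost at h1; gcongr)
  calc ‖N.displacement z c‖ = ‖z (Sum.inr c) + N.residual z c‖ := by simp [residual]
    _ ≤ _ := (norm_add_le _ _).trans (add_le_add (N.mem_feasible_iff.1 hz c) h2)

theorem exists_norm_x_sub_le_of_adj {i j : Fin n} (hij : N.graph.Adj i j) (C : ℝ) :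
    ∃ B, ∀ z ∈ N.feasible, N.F z ≤ C → ‖N.x z i - N.x z j‖ ≤ B := by
  let e : N.Edge := ⟨s(i, j), hij⟩
  refine ⟨_, fun z hz hC => le_trans (le_of_eq ?_) (norm_displacement_le hz hC (Sum.inl e))⟩
  have h : s(N.tail e, N.head e) = s(i, j) := N.orient e
  rcases Sym2.eq_iff.1 h with ⟨h1, h2⟩ | ⟨h1, h2⟩
  · simp only [displacement, Sum.elim_inl, h1, h2]
  · simp only [displacement, Sum.elim_inl, h1, h2]
    exact norm_sub_rev _ _

/-- Induction along a path from an anchored node: its anchor bounds that node, and each edge bounds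
the difference of its endpoints. -/
theorem exists_norm_x_le (hconn : N.graph.Connected) (hanchor : ∃ i, (N.anchorsOf i).Nonempty)
    (C : ℝ) (j : Fin n) : ∃ B, ∀ z ∈ N.feasible, N.F z ≤ C → ‖N.x z j‖ ≤ B := by
  obtain ⟨i, k, hk⟩ := hanchor
  have hreach := (SimpleGraph.reachable_iff_reflTransGen i j).1 (hconn.preconnected i j)
  induction hreach with
  | refl =>
    let l : N.Link := ⟨i, k, hk⟩
    refine ⟨N.range (Sum.inr l) + (C + N.radius (Sum.inr l) ^ 2 / 2) / N.radius (Sum.inr l)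
      + ‖N.anchorPos k‖, fun z hz hC => ?_⟩
    have h := norm_displacement_le hz hC (Sum.inr l)
    calc ‖N.x z i‖ = ‖N.displacement z (Sum.inr l) + N.anchorPos k‖ := by
          simp [displacement, l]
      _ ≤ _ := (norm_add_le _ _).trans (by gcongr)
  | @tail a b _ hab ih =>
    obtain ⟨B, hB⟩ := ih
    obtain ⟨B', hB'⟩ := exists_norm_x_sub_le_of_adj hab C
    refine ⟨B + B', fun z hz hC => ?_⟩
    calc ‖N.x z b‖ = ‖N.x z a - (N.x z a - N.x z b)‖ := by rw [sub_sub_cancel]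
      _ ≤ _ := (norm_sub_le _ _).trans (add_le_add (hB z hz hC) (hB' z hz hC))

theorem isCompact_sublevel (hconn : N.graph.Connected)
    (hanchor : ∃ i, (N.anchorsOf i).Nonempty) (C : ℝ) :
    IsCompact {z | z ∈ N.feasible ∧ N.F z ≤ C} := by
  refine Metric.isCompact_of_isClosed_isBounded
    (N.isClosed_feasible.inter (isClosed_le N.continuous_F continuous_const)) ?_
  choose B hB using exists_norm_x_le hconn hanchor C
  refine isBounded_iff_forall_norm_le.2
    ⟨√(∑ c : N.Coord, (Sum.elim B N.range c) ^ 2), fun z hz => ?_⟩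
  rw [PiLp.norm_eq_of_L2]
  refine Real.sqrt_le_sqrt (Finset.sum_le_sum fun c _ => ?_)
  gcongr
  rcases c with i | c
  exacts [hB i z hz.1 hz.2, N.mem_feasible_iff.1 hz.1 c]

theorem exists_isMinOn_feasible (hconn : N.graph.Connected)
    (hanchor : ∃ i, (N.anchorsOf i).Nonempty) :
    ∃ z ∈ N.feasible, IsMinOn N.F N.feasible z := by
  have h0 : (0 : N.State) ∈ N.feasible :=
    N.mem_feasible_iff.2 fun c => by simpa using N.range_nonneg c
  obtain ⟨z, hz, hmin⟩ := (isCompact_sublevel hconn hanchor (N.F 0)).exists_isMinOn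
    ⟨0, h0, le_rfl⟩ N.continuous_F.continuousOn
  refine ⟨z, hz.1, fun u hu => ?_⟩
  by_cases h : N.F u ≤ N.F 0
  · exact hmin ⟨hu, h⟩
  · exact hz.2.trans (not_le.1 h).le

theorem Fstar_le {z : N.State} (hz : z ∈ N.feasible) : N.Fstar ≤ N.F z :=
  csInf_le ⟨0, by rintro _ ⟨u, _, rfl⟩; exact N.F_nonneg u⟩ ⟨z, hz, rfl⟩

theorem solutionSet_nonempty (hconn : N.graph.Connected)
    (hanchor : ∃ i, (N.anchorsOf i).Nonempty) : N.solutionSet.Nonempty := by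
  obtain ⟨z, hz, hmin⟩ := exists_isMinOn_feasible hconn hanchor
  refine ⟨z, hz, le_antisymm ?_ (Fstar_le hz)⟩
  refine le_csInf ⟨_, z, hz, rfl⟩ ?_
  rintro _ ⟨u, hu, rfl⟩
  exact hmin hu

/-! ### Trajectories -/

variable {χ : ℕ → Fin n} {z : ℕ → N.State}

theorem IsAsyncRun.slack_zero (h : N.IsAsyncRun χ z) (c : N.Term) :
    z 0 (Sum.inr c) = ballProj (N.range c) (N.displacement (z 0) c) := by
  rcases c with e | l
  exacts [h.init_y e, h.init_w l]

theorem IsAsyncRun.feasible (h : N.IsAsyncRun χ z) : ∀ t, z t ∈ N.feasible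
  | 0 => N.mem_feasible_iff.2 fun c => by
      rw [h.slack_zero]
      exact norm_ballProj_le (N.range_nonneg c) _
  | t + 1 => (h.step t).1.1

theorem IsAsyncRun.slackOptimal (h : N.IsAsyncRun χ z) (t : ℕ) : N.SlackOptimal (z t) := by
  induction t with
  | zero =>
    intro c v hv
    rw [termGrad, residual, h.slack_zero]
    exact inner_ballProj_residual_nonpos (N.radius_pos c).le (N.range_nonneg c) _ hv
  | succ t ih => exact (h.step t).slackOptimal ih

theorem IsAsyncRun.antitone_F (h : N.IsAsyncRun χ z) : Antitone fun t => N.F (z t) :=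
  antitone_nat_of_succ_le fun t => by
    have h1 := (h.step t).descent (h.feasible t)
    have h2 : 0 ≤ ∑ c, ‖N.termGrad (z t) c - N.termGrad (z (t + 1)) c‖ ^ 2 :=
      Finset.sum_nonneg fun c _ => sq_nonneg _
    linarith

theorem IsAsyncRun.exists_tendsto_F (h : N.IsAsyncRun χ z) :
    ∃ a, Tendsto (fun t => N.F (z t)) atTop (𝓝 a) :=
  ⟨_, tendsto_atTop_ciInf h.antitone_F ⟨0, by rintro _ ⟨t, rfl⟩; exact N.F_nonneg _⟩⟩

/-- The decrements of the convergent sequence `F (z t)` tend to 0 and dominate the squared changes.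
-/
theorem IsAsyncRun.tendsto_termGrad_sub (h : N.IsAsyncRun χ z) (c : N.Term) :
    Tendsto (fun t => ‖N.termGrad (z t) c - N.termGrad (z (t + 1)) c‖) atTop (𝓝 0) := by
  obtain ⟨a, ha⟩ := h.exists_tendsto_F
  have h1 : Tendsto (fun t => 2 * (N.F (z t) - N.F (z (t + 1)))) atTop (𝓝 0) := by
    simpa using (ha.sub ((tendsto_add_atTop_iff_nat 1).2 ha)).const_mul 2
  have h2 : Tendsto (fun t => ‖N.termGrad (z t) c - N.termGrad (z (t + 1)) c‖ ^ 2) atTop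
      (𝓝 0) := by
    refine squeeze_zero (fun _ => sq_nonneg _) (fun t => ?_) h1
    have h3 := (h.step t).descent (h.feasible t)
    have h4 := Finset.single_le_sum
      (f := fun c => ‖N.termGrad (z t) c - N.termGrad (z (t + 1)) c‖ ^ 2)
      (fun c _ => sq_nonneg _) (Finset.mem_univ c)
    linarith
  simpa [Function.comp_def, Real.sqrt_sq] using (Real.continuous_sqrt.tendsto 0).comp h2

theorem IsAsyncRun.tendsto_nodeGrad_sub (h : N.IsAsyncRun χ z) (i : Fin n) (k : ℕ) :
    Tendsto (fun t => N.nodeGrad (z t) i - N.nodeGrad (z (t + k)) i) atTop (𝓝 0) := by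
  have hstep : Tendsto (fun t => N.nodeGrad (z t) i - N.nodeGrad (z (t + 1)) i) atTop
      (𝓝 0) := by
    refine squeeze_zero_norm (fun t => norm_nodeGrad_sub_le _ _ i) ?_
    simpa using tendsto_finsetSum Finset.univ fun c _ => h.tendsto_termGrad_sub c
  induction k with
  | zero => simp
  | succ k ih =>
    have h1 := ih.add ((tendsto_add_atTop_iff_nat k).2 hstep)
    simpa [add_assoc] using h1

/-- If the nodes are infinitely often activated in the order `0, 1, …, n - 1`, then the cost
converges to the optimal value. -/
theorem IsAsyncRun.tendsto_F (hconn : N.graph.Connected)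
    (hanchor : ∃ i, (N.anchorsOf i).Nonempty) (h : N.IsAsyncRun χ z)
    (hχ : ∃ᶠ t in atTop, ∀ i : Fin n, χ (t + i + 1) = i) :
    Tendsto (fun t => N.F (z t)) atTop (𝓝 N.Fstar) := by
  obtain ⟨a, ha⟩ := h.exists_tendsto_F
  obtain ⟨u, hu, huF⟩ := solutionSet_nonempty hconn hanchor
  choose B hB using exists_norm_x_le hconn hanchor (N.F (z 0))
  have hlim : Tendsto (fun t => N.Fstar + ∑ i : Fin n,
      ‖N.nodeGrad (z t) i - N.nodeGrad (z (t + (i + 1))) i‖ * (B i + ‖N.x u i‖)) atTop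
      (𝓝 N.Fstar) := by
    simpa using (tendsto_finsetSum Finset.univ fun (i : Fin n) _ =>
      (h.tendsto_nodeGrad_sub i (i + 1)).norm.mul_const (B i + ‖N.x u i‖)).const_add N.Fstar
  have hle : a ≤ N.Fstar := by
    -- The limit `a` already exists, so it suffices to compare at the starts of the ordered windows.
    refine le_of_tendsto_of_tendsto_of_frequently ha hlim (hχ.mono fun t ht => ?_)
    have h1 := (h.slackOptimal t).F_sub_le hu
    rw [huF] at h1
    have h2 : ∑ i, ‖N.nodeGrad (z t) i‖ * ‖z t (Sum.inl i) - u (Sum.inl i)‖ ≤ ∑ i : Fin n,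
        ‖N.nodeGrad (z t) i - N.nodeGrad (z (t + (i + 1))) i‖ * (B i + ‖N.x u i‖) := by
      refine Finset.sum_le_sum fun i _ => ?_
      -- Node `i` acts at step `t + i + 1`, which produces exactly this iterate.
      have h3 : N.nodeGrad (z (t + (i + 1))) i = 0 := by
        have h4 := h.step (t + i)
        rw [ht i] at h4
        exact h4.nodeGrad_eq_zero
      rw [h3, sub_zero]
      gcongr
      exact (norm_sub_le _ _).trans
        (add_le_add (hB i _ (h.feasible t) (h.antitone_F (Nat.zero_le t))) le_rfl)
    linarith
  have hge : N.Fstar ≤ a := ge_of_tendsto' ha fun t => Fstar_le (h.feasible t)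
  rwa [le_antisymm hge hle]

/-- A minimizing sequence of feasible points approaches the solution set. -/
theorem tendsto_infDist_solutionSet (hconn : N.graph.Connected)
    (hanchor : ∃ i, (N.anchorsOf i).Nonempty) (hz : ∀ t, z t ∈ N.feasible)
    (hF : Tendsto (fun t => N.F (z t)) atTop (𝓝 N.Fstar)) :
    Tendsto (fun t => Metric.infDist (z t) N.solutionSet) atTop (𝓝 0) := by
  rw [tendsto_order]
  refine ⟨fun a ha => Eventually.of_forall fun t => ha.trans_le Metric.infDist_nonneg,
    fun ε hε => ?_⟩
  -- Near-optimal points at distance at least `ε` form a compact set; if it is nonempty, its minimal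
  -- cost exceeds `F⋆`, so the sequence eventually leaves it.
  let K : Set N.State := {u | u ∈ N.feasible ∧ N.F u ≤ N.Fstar + 1} ∩
    {u | ε ≤ Metric.infDist u N.solutionSet}
  have hKc : IsCompact K := (isCompact_sublevel hconn hanchor _).inter_right
    (isClosed_le continuous_const (Metric.continuous_infDist_pt _))
  have hev := hF.eventually_le_const (lt_add_one N.Fstar)
  rcases K.eq_empty_or_nonempty with hemp | hne
  · filter_upwards [hev] with t ht
    by_contra hcon
    have hmem : z t ∈ K := ⟨⟨hz t, ht⟩, not_lt.1 hcon⟩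
    simp [hemp] at hmem
  · obtain ⟨u, hu, hmin⟩ := hKc.exists_isMinOn hne N.continuous_F.continuousOn
    have hlt : N.Fstar < N.F u := by
      refine lt_of_le_of_ne (Fstar_le hu.1.1) fun heq => ?_
      have h1 : ε ≤ Metric.infDist u N.solutionSet := hu.2
      rw [Metric.infDist_zero_of_mem (s := N.solutionSet) ⟨hu.1.1, heq.symm⟩] at h1
      linarith
    filter_upwards [hev, hF.eventually_lt_const hlt] with t ht1 ht2
    by_contra hcon
    exact absurd (hmin ⟨⟨hz t, ht1⟩, not_lt.1 hcon⟩ : N.F u ≤ N.F (z t)) (not_le.2 ht2)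

end Network

end

/-! ### Random activations and the conclusion -/

/-- Independent activations with fixed positive probabilities almost surely run through all the
nodes in order infinitely often. -/
theorem ae_frequently_forall_eq {n : ℕ} {Ω : Type*} [MeasurableSpace Ω] {μ : Measure Ω}
    [IsProbabilityMeasure μ] {P : Fin n → ℝ} (hP : ∀ i, 0 < P i) {χ : ℕ → Ω → Fin n}
    (hmeas : ∀ t, Measurable (χ t)) (hindep : iIndepFun χ μ)
    (hlaw : ∀ t i, μ.real {ω | χ t ω = i} = P i) :
    ∀ᵐ ω ∂μ, ∃ᶠ t in atTop, ∀ i : Fin n, χ (t + i + 1) ω = i := by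
  rcases Nat.eq_zero_or_pos n with rfl | hn
  · exact Eventually.of_forall fun ω => Frequently.of_forall fun t i => i.elim0
  -- Time is cut into disjoint blocks of length `n`, which makes the events `A k` below independent.
  have hg : Function.Injective fun q : ℕ × Fin n => q.1 * n + q.2 + 1 := by
    rintro ⟨k, i⟩ ⟨l, j⟩ h
    have h : n * k + i = n * l + j := by
      simp only [add_left_inj] at h
      rw [mul_comm n k, mul_comm n l, h]
    have h1 := congrArg (· / n) h
    have h2 := congrArg (· % n) h
    simp only [Nat.mul_add_div hn, Nat.div_eq_of_lt i.2, Nat.div_eq_of_lt j.2, add_zero,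
      Nat.mul_add_mod, Nat.mod_eq_of_lt i.2, Nat.mod_eq_of_lt j.2] at h1 h2
    rw [h1, Fin.ext h2]
  have hξ := hindep.precomp hg
  let A : ℕ → Set Ω := fun k => {ω | ∀ i : Fin n, χ (k * n + i + 1) ω = i}
  have hinter : ∀ S : Finset ℕ, μ (⋂ k ∈ S, A k) = ∏ k ∈ S, ∏ i, ENNReal.ofReal (P i) := by
    intro S
    have h1 := hξ.measure_inter_preimage_eq_mul (S ×ˢ Finset.univ) (sets := fun q => {q.2})
      (fun q _ => measurableSet_singleton _)
    have h2 : ⋂ k ∈ S, A k = ⋂ q ∈ S ×ˢ (Finset.univ : Finset (Fin n)),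
        χ (q.1 * n + q.2 + 1) ⁻¹' {q.2} := by
      ext ω
      simp only [A, Set.mem_iInter, Set.mem_ofPred_eq, Finset.mem_product, Finset.mem_univ,
        and_true, Set.mem_preimage, Set.mem_singleton_iff, Prod.forall]
      exact ⟨fun h k i hk => h k hk i, fun h k hk i => h k i hk⟩
    rw [h2, h1, Finset.prod_product]
    refine Finset.prod_congr rfl fun k _ => Finset.prod_congr rfl fun i _ => ?_
    rw [← hlaw (k * n + i + 1) i, ofReal_measureReal]
    rfl
  have hA : ∀ k, μ (A k) = ∏ i, ENNReal.ofReal (P i) := fun k => by simpa using hinter {k}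
  have hAm : ∀ k, MeasurableSet (A k) := fun k => by
    simp only [A, Set.ofPred_forall]
    exact MeasurableSet.iInter fun i => hmeas _ (measurableSet_singleton i)
  -- Second Borel–Cantelli lemma: the `A k` all have the same positive probability `∏ i, P i`.
  have hlimsup : μ (limsup A atTop) = 1 := by
    refine measure_limsup_eq_one hAm ((iIndepSet_iff_meas_biInter hAm).2 fun S => ?_) ?_
    · simp only [hinter, hA]
    · simp only [hA]
      exact ENNReal.tsum_const_eq_top_of_ne_zero
        (Finset.prod_ne_zero_iff.2 fun i _ => (ENNReal.ofReal_pos.2 (hP i)).ne')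
  have hae : ∀ᵐ ω ∂μ, ω ∈ limsup A atTop :=
    (mem_ae_iff_prob_eq_one (MeasurableSet.measurableSet_limsup hAm)).2 hlimsup
  filter_upwards [hae] with ω hω
  have hfreq : ∃ᶠ k in atTop, ω ∈ A k := mem_limsup_iff_frequently_mem.1 hω
  exact (tendsto_id.atTop_mul_const' hn).frequently hfreq

theorem theorem1 {p n m : ℕ} (N : Network p n m)
    (hconn : N.graph.Connected)
    (hanchor : ∃ i, (N.anchorsOf i).Nonempty)
    {Ω : Type*} [MeasurableSpace Ω] (μ : Measure Ω) [IsProbabilityMeasure μ]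
    (P : Fin n → ℝ) (hP : ∀ i, 0 < P i)
    (χ : ℕ → Ω → Fin n)
    (hmeas : ∀ t, Measurable (χ t))
    (hindep : iIndepFun χ μ)
    (hlaw : ∀ t i, μ.real {ω | χ t ω = i} = P i)
    (z : ℕ → Ω → N.State)
    (hz : ∀ ω, N.IsAsyncRun (fun t => χ t ω) (fun t => z t ω)) :
    N.solutionSet.Nonempty ∧
    (∀ᵐ ω ∂μ, Tendsto (fun t => Metric.infDist (z t ω) N.solutionSet) atTop (𝓝 0)) ∧
    (∀ᵐ ω ∂μ, Tendsto (fun t => N.F (z t ω)) atTop (𝓝 N.Fstar)) := by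
  have hF : ∀ᵐ ω ∂μ, Tendsto (fun t => N.F (z t ω)) atTop (𝓝 N.Fstar) := by
    filter_upwards [ae_frequently_forall_eq hP hmeas hindep hlaw] with ω hω
    exact (hz ω).tendsto_F hconn hanchor hω
  refine ⟨Network.solutionSet_nonempty hconn hanchor, ?_, hF⟩
  filter_upwards [hF] with ω hω
  exact Network.tendsto_infDist_solutionSet hconn hanchor (hz ω).feasible hω
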